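/- There is an absolute constant $c>0$ such that for every infinite sequence $(z_n)_{n=1}^{\infty}$ of complex numbers with $|z_n|=1$ for all $n$, the inequality $$ \left\| \log \prod_{k=1}^{N} |z-z_k| \right\|_{L^2(|z|=1)} \ \ge\ c\,\sqrt{\log N} $$ holds for infinitely many $N$, where the $L^2$-norm is taken in the variable $z$ over the unit circle with respect to arc length. This rate is optimal up to the value of the constant: there exist a constant $C>0$ and an infinite sequence $(z_n)_{n=1}^{\infty}$ with $|z_n|=1$ for all $n$ such that $$ \left\| \log \prod_{k=1}^{N} |z-z_k| \right\|_{L^2(|z|=1)} \ \le\ C\,\sqrt{\log N} \qquad \text{for all } N\ge 2. $$ -/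

import Mathlib

/-- The `L²` norm, with values in `[0, ∞]`, of a function on the unit circle `|w| = 1` with respect
to arc length (the circle is parametrised as `w = e^{iθ}`, `0 < θ ≤ 2π`). -/
noncomputable def circleL2Norm (f : ℂ → ℝ) : ENNReal :=
  MeasureTheory.eLpNorm (fun θ : ℝ => f (circleMap 0 1 θ)) 2
    (MeasureTheory.volume.restrict (Set.Ioc 0 (2 * Real.pi)))

/-- The function `w ↦ log ∏_{k ≤ N} |w - z_k|`, where `z 0, z 1, …, z (N - 1)` are the first `N`
terms of the sequence `z`. Its value at the finitely many zeros of the product is immaterial. -/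
noncomputable def logProd (z : ℕ → ℂ) (N : ℕ) (w : ℂ) : ℝ :=
  Real.log ‖∏ k ∈ Finset.range N, (w - z k)‖

open MeasureTheory Filter Topology intervalIntegral
open scoped ComplexConjugate

/-! On the unit circle `log |w - z|` with `|z| = 1` has mean zero and pairing `-π z^n / n` with
`w^n` for `n ≥ 1`, so Parseval turns the squared norm into `π ∑ |p_m(N)|² / m²`, where `p_m(N)` is
the `m`-th power sum of the first `N` points (`exists_hasSum_and_circleL2Norm_logProd_eq`). Both
claims thus concern power sums.

Lower bound: any `T = 2^j` consecutive points have power sums with `∑_{1 ≤ m < 2T} |·|² ≥ T²/2`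
(`sq_card_div_two_le_sum_sq_norm`). These are differences `p_m(N + T) - p_m(N)`, so `N` or `N + T`
carries energy bounded below at scale `j`. Averaging over `N < 2^(L+1)` and adding the `L` scales,
whose weights at frequency `m` total `O(1/m²)`, gives some `N` with energy of order `L`
(`exists_energy_ge`).

Upper bound: van der Corput points come in antipodal pairs whose squares reproduce the sequence.
Hence `|p_m(N)|` is at most the sum of the `2^a` dividing `m` with `2^a ≤ N`, and each of the `O(log
N)` values of `a` contributes `O(1)` to the energy (`sum_sq_powerSum_vdcSeq_le`). -/

/-! ### Power sums of the van der Corput sequence -/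

/-- The arguments of the points of the van der Corput sequence on the unit circle. -/
noncomputable def vdcArg : ℕ → ℝ
  | 0 => 0
  | n + 1 => vdcArg ((n + 1) / 2) / 2 + Real.pi * (((n + 1) % 2 : ℕ) : ℝ)
decreasing_by omega

/-- The van der Corput sequence in base two on the unit circle. -/
noncomputable def vdcSeq (n : ℕ) : ℂ := Complex.exp (vdcArg n * Complex.I)

lemma vdcArg_eq (n : ℕ) : vdcArg n = vdcArg (n / 2) / 2 + Real.pi * ((n % 2 : ℕ) : ℝ) := by
  cases n with
  | zero => simp [vdcArg]
  | succ n => rw [vdcArg]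

lemma norm_vdcSeq (n : ℕ) : ‖vdcSeq n‖ = 1 := Complex.norm_exp_ofReal_mul_I _

lemma vdcSeq_two_mul_sq (n : ℕ) : vdcSeq (2 * n) ^ 2 = vdcSeq n := by
  have h : vdcArg (2 * n) = vdcArg n / 2 := by
    rw [vdcArg_eq (2 * n)]; simp
  rw [vdcSeq, vdcSeq, h, ← Complex.exp_nat_mul]
  congr 1
  push_cast
  ring

lemma vdcSeq_two_mul_add_one (n : ℕ) : vdcSeq (2 * n + 1) = -vdcSeq (2 * n) := by
  have h : vdcArg (2 * n + 1) = vdcArg (2 * n) + Real.pi := by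
    rw [vdcArg_eq (2 * n), vdcArg_eq (2 * n + 1)]
    have h1 : (2 * n + 1) / 2 = n := by omega
    have h2 : (2 * n + 1) % 2 = 1 := by omega
    simp [h1, h2]
  rw [vdcSeq, vdcSeq, h]
  push_cast
  rw [add_mul, Complex.exp_add, Complex.exp_pi_mul_I]
  ring

/-- The power sums of the first `N` terms of a sequence. -/
noncomputable def powerSum (z : ℕ → ℂ) (N m : ℕ) : ℂ := ∑ k ∈ Finset.range N, z k ^ m

lemma powerSum_vdcSeq_two_mul_of_odd (N m : ℕ) (hm : Odd m) :
    powerSum vdcSeq (2 * N) m = 0 := by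
  induction N with
  | zero => simp [powerSum]
  | succ N ih =>
    rw [powerSum] at ih ⊢
    rw [mul_add, mul_one, Finset.sum_range_succ, Finset.sum_range_succ, ih,
      vdcSeq_two_mul_add_one, hm.neg_pow]
    ring

lemma powerSum_vdcSeq_two_mul_two_mul (N m : ℕ) :
    powerSum vdcSeq (2 * N) (2 * m) = 2 * powerSum vdcSeq N m := by
  induction N with
  | zero => simp [powerSum]
  | succ N ih =>
    rw [powerSum] at ih ⊢
    rw [powerSum] at ih ⊢
    rw [mul_add, mul_one, Finset.sum_range_succ, Finset.sum_range_succ, ih,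
      Finset.sum_range_succ, vdcSeq_two_mul_add_one, (even_two_mul m).neg_pow, pow_mul,
      vdcSeq_two_mul_sq]
    ring

/-- Induction on binary digits: antipodal pairs cancel for odd `m` and halve both `N` and `m` for
even `m`, at the cost of a factor 2. An unpaired last point adds at most 1, the `a = 0` term. -/
lemma norm_powerSum_vdcSeq_le (L N m : ℕ) (hN : N < 2 ^ L) :
    ‖powerSum vdcSeq N m‖ ≤ ∑ a ∈ Finset.range L, if 2 ^ a ∣ m then (2 : ℝ) ^ a else 0 := by
  induction L generalizing N m with
  | zero =>
    have : N = 0 := by simpa using hN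
    simp [this, powerSum]
  | succ L ih =>
    have heven : ‖powerSum vdcSeq (2 * (N / 2)) m‖ ≤
        ∑ a ∈ Finset.range L, if 2 ^ (a + 1) ∣ m then (2 : ℝ) ^ (a + 1) else 0 := by
      rcases Nat.even_or_odd' m with ⟨m', rfl | rfl⟩
      · rw [powerSum_vdcSeq_two_mul_two_mul, norm_mul, Complex.norm_two]
        refine (mul_le_mul_of_nonneg_left (ih (N / 2) m' (by omega)) zero_le_two).trans_eq ?_
        rw [Finset.mul_sum]
        refine Finset.sum_congr rfl fun a _ => ?_
        have : 2 ^ (a + 1) ∣ 2 * m' ↔ 2 ^ a ∣ m' := by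
          rw [pow_succ', Nat.mul_dvd_mul_iff_left two_pos]
        simp only [this, mul_ite, mul_zero, pow_succ' (2 : ℝ)]
      · rw [powerSum_vdcSeq_two_mul_of_odd _ _ (odd_two_mul_add_one m'), norm_zero]
        positivity
    rw [Finset.sum_range_succ']
    simp only [pow_zero, one_dvd, if_true]
    rcases Nat.even_or_odd' N with ⟨n, rfl | rfl⟩
    · rw [Nat.mul_div_cancel_left n two_pos] at heven
      linarith
    · have h1 : (2 * n + 1) / 2 = n := by omega
      rw [h1] at heven
      have : powerSum vdcSeq (2 * n + 1) m = powerSum vdcSeq (2 * n) m + vdcSeq (2 * n) ^ m :=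
        Finset.sum_range_succ _ _
      rw [this]
      refine (norm_add_le _ _).trans ?_
      rw [norm_pow, norm_vdcSeq, one_pow]
      linarith

/-- The exponents `a` with `2^a ∣ m` form an initial segment, so the sum is geometric and less than
twice its last term. -/
lemma sq_sum_two_pow_dvd_le (L m : ℕ) :
    (∑ a ∈ Finset.range L, if 2 ^ a ∣ m then (2 : ℝ) ^ a else 0) ^ 2 ≤
      4 * ∑ a ∈ Finset.range L, if 2 ^ a ∣ m then (4 : ℝ) ^ a else 0 := by
  induction L with
  | zero => simp
  | succ L ih =>
    by_cases h : 2 ^ L ∣ m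
    · have hs : ∑ a ∈ Finset.range (L + 1), (if 2 ^ a ∣ m then (2 : ℝ) ^ a else 0) =
          2 ^ (L + 1) - 1 := by
        rw [Finset.sum_congr rfl fun a ha => if_pos ((pow_dvd_pow 2
          (Nat.lt_succ_iff.mp (Finset.mem_range.mp ha))).trans h), geom_sum_eq (by norm_num)]
        norm_num
      have hq : (0 : ℝ) ≤ ∑ a ∈ Finset.range L, if 2 ^ a ∣ m then (4 : ℝ) ^ a else 0 := by
        positivity
      rw [hs, Finset.sum_range_succ _ L, if_pos h]
      have h1 : (1 : ℝ) ≤ 2 ^ L := one_le_pow₀ (by norm_num)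
      have h4 : (4 : ℝ) ^ L = (2 ^ L) ^ 2 := by rw [← pow_mul, mul_comm, pow_mul]; norm_num
      rw [h4, pow_succ (2 : ℝ) L]
      nlinarith
    · rw [Finset.sum_range_succ, Finset.sum_range_succ, if_neg h, if_neg h, add_zero, add_zero]
      exact ih

/-- The multiples of `d ≥ 1` contribute `(∑ 1 / m²) / d²` to `∑ 1 / m²`. -/
lemma sum_range_ite_dvd_div_sq_le (M d : ℕ) (hd : 0 < d) :
    ∑ m ∈ Finset.range M, (if d ∣ m then (d : ℝ) ^ 2 else 0) / (m : ℝ) ^ 2 ≤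
      ∑' m : ℕ, 1 / (m : ℝ) ^ 2 := by
  have hsum : Summable fun m : ℕ => 1 / (m : ℝ) ^ 2 := Real.summable_one_div_nat_pow.mpr one_lt_two
  have hd' : (d : ℝ) ≠ 0 := by positivity
  simp only [ite_div, zero_div]
  rw [← Finset.sum_filter]
  calc ∑ m ∈ Finset.range M with d ∣ m, (d : ℝ) ^ 2 / (m : ℝ) ^ 2
      = ∑ m ∈ (Finset.range M).filter (d ∣ ·), 1 / (((m / d : ℕ) : ℝ)) ^ 2 := by
        refine Finset.sum_congr rfl fun m hm => ?_
        obtain ⟨k, rfl⟩ := (Finset.mem_filter.mp hm).2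
        rw [Nat.mul_div_cancel_left k hd]
        push_cast
        rw [mul_pow, ← div_div, div_self (pow_ne_zero 2 hd')]
    _ = ∑ k ∈ ((Finset.range M).filter (d ∣ ·)).image (· / d), 1 / (k : ℝ) ^ 2 := by
        rw [Finset.sum_image]
        intro a ha b hb hab
        exact (Nat.div_left_inj (Finset.mem_filter.mp ha).2 (Finset.mem_filter.mp hb).2).mp hab
    _ ≤ _ := hsum.sum_le_tsum _ fun _ _ => by positivity

lemma sum_sq_powerSum_vdcSeq_le (L N M : ℕ) (hN : N < 2 ^ L) :
    ∑ m ∈ Finset.range M, ‖powerSum vdcSeq N m‖ ^ 2 / (m : ℝ) ^ 2 ≤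
      4 * L * ∑' m : ℕ, 1 / (m : ℝ) ^ 2 := by
  calc ∑ m ∈ Finset.range M, ‖powerSum vdcSeq N m‖ ^ 2 / (m : ℝ) ^ 2
      ≤ ∑ m ∈ Finset.range M,
          (4 * ∑ a ∈ Finset.range L, if 2 ^ a ∣ m then (4 : ℝ) ^ a else 0) / (m : ℝ) ^ 2 := by
        gcongr with m
        exact (pow_le_pow_left₀ (norm_nonneg _) (norm_powerSum_vdcSeq_le L N m hN) 2).trans
          (sq_sum_two_pow_dvd_le L m)
    _ = 4 * ∑ a ∈ Finset.range L, ∑ m ∈ Finset.range M,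
          (if 2 ^ a ∣ m then (((2 ^ a : ℕ) : ℝ)) ^ 2 else 0) / (m : ℝ) ^ 2 := by
        rw [Finset.sum_comm, Finset.mul_sum]
        refine Finset.sum_congr rfl fun m _ => ?_
        rw [← Finset.sum_div, mul_div_assoc]
        congr 3
        refine funext fun a => ?_
        have : (((2 ^ a : ℕ) : ℝ)) ^ 2 = 4 ^ a := by
          push_cast
          rw [← pow_mul, mul_comm, pow_mul]
          norm_num
        rw [this]
    _ ≤ 4 * ∑ a ∈ Finset.range L, ∑' m : ℕ, 1 / (m : ℝ) ^ 2 := by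
        gcongr with a
        exact sum_range_ite_dvd_div_sq_le M (2 ^ a) (by positivity)
    _ = 4 * L * ∑' m : ℕ, 1 / (m : ℝ) ^ 2 := by
        rw [Finset.sum_const, Finset.card_range, nsmul_eq_mul, mul_assoc]

/-! ### Turán-type lower bound for power sums -/

/-- A finite Gram-matrix form of Turán's inequality: `T` points on the unit circle cannot all have
small power sums of order less than `K`. -/
lemma card_mul_sq_le_sum_sq_norm {ι : Type*} (s : Finset ι) (z : ι → ℂ) (hz : ∀ k ∈ s, ‖z k‖ = 1)
    (K : ℕ) :
    (s.card : ℝ) * K ^ 2 ≤ ∑ a ∈ Finset.range K, ∑ b ∈ Finset.range K,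
      ‖∑ k ∈ s, z k ^ a * conj (z k) ^ b‖ ^ 2 := by
  -- For the Vandermonde matrix `V = (z_k^a)`, this says that `V V*` and `V* V` have the same
  -- Frobenius norm.
  have key : ((∑ a ∈ Finset.range K, ∑ b ∈ Finset.range K,
      ‖∑ k ∈ s, z k ^ a * conj (z k) ^ b‖ ^ 2 : ℝ) : ℂ) =
      ((∑ k ∈ s, ∑ l ∈ s, ‖∑ a ∈ Finset.range K, z k ^ a * conj (z l) ^ a‖ ^ 2 : ℝ) : ℂ) := by
    push_cast
    simp only [← Complex.mul_conj', map_sum, map_mul, map_pow, Complex.conj_conj,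
      Finset.sum_mul_sum]
    calc _ = ∑ a ∈ Finset.range K, ∑ k ∈ s, ∑ b ∈ Finset.range K, ∑ l ∈ s,
          z k ^ a * conj (z k) ^ b * (conj (z l) ^ a * z l ^ b) :=
          Finset.sum_congr rfl fun a _ => Finset.sum_comm
      _ = ∑ k ∈ s, ∑ a ∈ Finset.range K, ∑ l ∈ s, ∑ b ∈ Finset.range K,
          z k ^ a * conj (z k) ^ b * (conj (z l) ^ a * z l ^ b) := by
          rw [Finset.sum_comm]
          exact Finset.sum_congr rfl fun k _ => Finset.sum_congr rfl fun a _ => Finset.sum_comm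
      _ = ∑ k ∈ s, ∑ l ∈ s, ∑ a ∈ Finset.range K, ∑ b ∈ Finset.range K,
          z k ^ a * conj (z k) ^ b * (conj (z l) ^ a * z l ^ b) :=
          Finset.sum_congr rfl fun k _ => Finset.sum_comm
      _ = _ := by
          refine Finset.sum_congr rfl fun k _ => Finset.sum_congr rfl fun l _ =>
            Finset.sum_congr rfl fun a _ => Finset.sum_congr rfl fun b _ => ?_
          ring
  rw [Complex.ofReal_inj.mp key, ← nsmul_eq_mul, ← Finset.sum_const]
  -- Only the diagonal `l = k` is kept; each such entry equals `K`.
  refine Finset.sum_le_sum fun k hk => ?_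
  refine le_trans (le_of_eq ?_) (Finset.single_le_sum
    (f := fun l => ‖∑ a ∈ Finset.range K, z k ^ a * conj (z l) ^ a‖ ^ 2)
    (fun l _ => by positivity) hk)
  have h1 : ∀ a, z k ^ a * conj (z k) ^ a = 1 := fun a => by
    rw [← mul_pow, Complex.mul_conj', hz k hk]; simp
  simp [h1]

/-- A sum over a row of a Toeplitz-type array is bounded by twice the sum of its symbol. -/
lemma sum_range_dist_le (V : ℕ → ℝ) (hV : ∀ m, 0 ≤ V m) (K a : ℕ) (ha : a < K) :
    ∑ b ∈ Finset.range K, V (Nat.dist a b) ≤ V 0 + 2 * ∑ m ∈ Finset.Ico 1 K, V m := by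
  -- On each side of `a` the distance to `a` is injective, so each positive distance occurs at most
  -- twice in the row.
  have hsplit : ∑ b ∈ Finset.range K, V (Nat.dist a b) =
      ∑ b ∈ Finset.range a, V (Nat.dist a b) + ∑ b ∈ Finset.Ico a K, V (Nat.dist a b) := by
    rw [Finset.range_eq_Ico, Finset.range_eq_Ico, Finset.sum_Ico_consecutive _ (Nat.zero_le _) ha.le]
  have h1 : ∑ b ∈ Finset.range a, V (Nat.dist a b) ≤ ∑ m ∈ Finset.Ico 1 K, V m := by
    rw [← Finset.sum_image (f := V) (g := fun b => Nat.dist a b)]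
    · refine Finset.sum_le_sum_of_subset_of_nonneg ?_ fun _ _ _ => hV _
      intro m hm
      obtain ⟨b, hb, rfl⟩ := Finset.mem_image.mp hm
      rw [Finset.mem_range] at hb
      simp only [Nat.dist, Finset.mem_Ico]
      omega
    · intro b hb c hc h
      simp only [Finset.coe_range, Set.mem_Iio, Nat.dist] at hb hc h
      omega
  have h2 : ∑ b ∈ Finset.Ico a K, V (Nat.dist a b) ≤ V 0 + ∑ m ∈ Finset.Ico 1 K, V m := by
    rw [Finset.sum_eq_sum_Ico_succ_bot ha, Nat.dist_self]
    gcongr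
    rw [← Finset.sum_image (f := V) (g := fun b => Nat.dist a b)]
    · refine Finset.sum_le_sum_of_subset_of_nonneg ?_ fun _ _ _ => hV _
      intro m hm
      obtain ⟨b, hb, rfl⟩ := Finset.mem_image.mp hm
      rw [Finset.mem_Ico] at hb
      simp only [Nat.dist, Finset.mem_Ico]
      omega
    · intro b hb c hc h
      simp only [Finset.coe_Ico, Set.mem_Ico, Nat.dist] at hb hc h
      omega
  linarith

lemma norm_sum_pow_mul_conj_pow {ι : Type*} (s : Finset ι) (z : ι → ℂ)
    (hz : ∀ k ∈ s, ‖z k‖ = 1) (a b : ℕ) :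
    ‖∑ k ∈ s, z k ^ a * conj (z k) ^ b‖ = ‖∑ k ∈ s, z k ^ Nat.dist a b‖ := by
  have h1 : ∀ k ∈ s, z k * conj (z k) = 1 := fun k hk => by
    rw [Complex.mul_conj', hz k hk]; simp
  rcases le_total b a with h | h
  · congr 1
    refine Finset.sum_congr rfl fun k hk => ?_
    obtain ⟨c, rfl⟩ := Nat.exists_eq_add_of_le h
    rw [Nat.dist_eq_sub_of_le_right h, Nat.add_sub_cancel_left, pow_add, mul_right_comm, ← mul_pow,
      h1 k hk, one_pow, one_mul]
  · rw [← Complex.norm_conj (∑ k ∈ s, z k ^ Nat.dist a b), map_sum]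
    congr 1
    refine Finset.sum_congr rfl fun k hk => ?_
    obtain ⟨c, rfl⟩ := Nat.exists_eq_add_of_le h
    rw [Nat.dist_eq_sub_of_le h, Nat.add_sub_cancel_left, map_pow, pow_add, ← mul_assoc, ← mul_pow,
      h1 k hk, one_pow, one_mul]

/-- The power sums of `T` unit complex numbers of positive order less than `2T` have mean square
of order at least `T`. -/
lemma sq_card_div_two_le_sum_sq_norm {ι : Type*} (s : Finset ι) (z : ι → ℂ)
    (hz : ∀ k ∈ s, ‖z k‖ = 1) :
    (s.card : ℝ) ^ 2 / 2 ≤ ∑ m ∈ Finset.Ico 1 (2 * s.card), ‖∑ k ∈ s, z k ^ m‖ ^ 2 := by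
  rcases Nat.eq_zero_or_pos s.card with h0 | hpos
  · simp [h0]
  set T := s.card with hT
  -- With `K = 2T` the lower bound is `4T³`, while the zero frequency accounts for only `2T³`; with
  -- `K = T` nothing would remain.
  have h1 := card_mul_sq_le_sum_sq_norm s z hz (2 * T)
  have h2 : ∑ a ∈ Finset.range (2 * T), ∑ b ∈ Finset.range (2 * T),
      ‖∑ k ∈ s, z k ^ a * conj (z k) ^ b‖ ^ 2 ≤
      ∑ a ∈ Finset.range (2 * T), (‖∑ k ∈ s, z k ^ 0‖ ^ 2 +
        2 * ∑ m ∈ Finset.Ico 1 (2 * T), ‖∑ k ∈ s, z k ^ m‖ ^ 2) := by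
    refine Finset.sum_le_sum fun a ha => ?_
    simp only [norm_sum_pow_mul_conj_pow s z hz]
    exact sum_range_dist_le (fun m => ‖∑ k ∈ s, z k ^ m‖ ^ 2) (fun _ => by positivity) _ _
      (Finset.mem_range.mp ha)
  have h3 : ‖∑ k ∈ s, z k ^ 0‖ = T := by simp [hT]
  rw [Finset.sum_const, Finset.card_range, nsmul_eq_mul, h3] at h2
  have h4 := h1.trans h2
  push_cast at h4
  have hTpos : (0 : ℝ) < T := by exact_mod_cast hpos
  set Q := ∑ m ∈ Finset.Ico 1 (2 * T), ‖∑ k ∈ s, z k ^ m‖ ^ 2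
  have h5 : (2 * (T : ℝ)) * (2 * T ^ 2) ≤ (2 * T) * (T ^ 2 + 2 * Q) := by linarith
  have h6 := le_of_mul_le_mul_left h5 (by positivity)
  linarith

/-! ### Averaging over initial segments and dyadic scales -/

/-- The part of the energy of the first `N` points at the frequencies of order at most `2 ^ j`. -/
noncomputable def scaleEnergy (z : ℕ → ℂ) (j N : ℕ) : ℝ :=
  ∑ m ∈ Finset.Ico 1 (2 * 2 ^ j), ‖powerSum z N m‖ ^ 2 / 4 ^ j

lemma scaleEnergy_nonneg (z : ℕ → ℂ) (j N : ℕ) : 0 ≤ scaleEnergy z j N := by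
  unfold scaleEnergy
  positivity

lemma powerSum_add_sub_powerSum (z : ℕ → ℂ) (N T m : ℕ) :
    powerSum z (N + T) m - powerSum z N m = ∑ k ∈ Finset.Ico N (N + T), z k ^ m := by
  rw [Finset.sum_Ico_eq_sub _ (Nat.le_add_right N T), powerSum, powerSum]

lemma one_div_four_le_scaleEnergy_add (z : ℕ → ℂ) (hz : ∀ n, ‖z n‖ = 1) (j N : ℕ) :
    1 / 4 ≤ scaleEnergy z j (N + 2 ^ j) + scaleEnergy z j N := by
  have h1 := sq_card_div_two_le_sum_sq_norm (Finset.Ico N (N + 2 ^ j)) z fun k _ => hz k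
  have hcard : (Finset.Ico N (N + 2 ^ j)).card = 2 ^ j := by simp
  rw [hcard] at h1
  simp only [← powerSum_add_sub_powerSum] at h1
  have h2 : ∑ m ∈ Finset.Ico 1 (2 * 2 ^ j), ‖powerSum z (N + 2 ^ j) m - powerSum z N m‖ ^ 2 ≤
      ∑ m ∈ Finset.Ico 1 (2 * 2 ^ j),
        2 * (‖powerSum z (N + 2 ^ j) m‖ ^ 2 + ‖powerSum z N m‖ ^ 2) := by
    gcongr with m
    calc ‖powerSum z (N + 2 ^ j) m - powerSum z N m‖ ^ 2
        ≤ (‖powerSum z (N + 2 ^ j) m‖ + ‖powerSum z N m‖) ^ 2 := by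
          gcongr
          exact norm_sub_le _ _
      _ ≤ _ := add_sq_le
  rw [← Finset.mul_sum, Finset.sum_add_distrib] at h2
  rw [scaleEnergy, scaleEnergy, ← Finset.sum_div, ← Finset.sum_div, ← add_div,
    le_div_iff₀ (by positivity)]
  have h4 : ((2 ^ j : ℕ) : ℝ) ^ 2 = 4 ^ j := by
    push_cast
    rw [← pow_mul, mul_comm, pow_mul]
    norm_num
  rw [h4] at h1
  linarith

/-- The two-segment bound is summed over `N < 2^L`. Since `j ≤ L`, both `N` and `N + 2^j` stay below
`2 * 2^L`, so each index is counted at most twice. -/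
lemma two_pow_div_eight_le_sum_scaleEnergy (z : ℕ → ℂ) (hz : ∀ n, ‖z n‖ = 1) (j L : ℕ)
    (hj : j ≤ L) :
    (2 : ℝ) ^ L / 8 ≤ ∑ N ∈ Finset.range (2 * 2 ^ L), scaleEnergy z j N := by
  have hjL : 2 ^ j ≤ 2 ^ L := pow_le_pow_right₀ one_le_two hj
  have h1 : (2 : ℝ) ^ L * (1 / 4) ≤
      ∑ N ∈ Finset.range (2 ^ L), (scaleEnergy z j (N + 2 ^ j) + scaleEnergy z j N) := by
    have := Finset.sum_le_sum (s := Finset.range (2 ^ L)) fun N _ =>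
      one_div_four_le_scaleEnergy_add z hz j N
    rw [Finset.sum_const, Finset.card_range, nsmul_eq_mul] at this
    exact_mod_cast this
  rw [Finset.sum_add_distrib] at h1
  have h2 : ∑ N ∈ Finset.range (2 ^ L), scaleEnergy z j N ≤
      ∑ N ∈ Finset.range (2 * 2 ^ L), scaleEnergy z j N :=
    Finset.sum_le_sum_of_subset_of_nonneg (Finset.range_mono (by omega))
      fun _ _ _ => scaleEnergy_nonneg _ _ _
  have h3 : ∑ N ∈ Finset.range (2 ^ L), scaleEnergy z j (N + 2 ^ j) ≤
      ∑ N ∈ Finset.range (2 * 2 ^ L), scaleEnergy z j N := by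
    rw [← Finset.sum_image (f := scaleEnergy z j) (g := fun N => N + 2 ^ j)
      (fun a _ b _ h => Nat.add_right_cancel h)]
    refine Finset.sum_le_sum_of_subset_of_nonneg ?_ fun _ _ _ => scaleEnergy_nonneg _ _ _
    intro m hm
    obtain ⟨b, hb, rfl⟩ := Finset.mem_image.mp hm
    rw [Finset.mem_range] at hb ⊢
    omega
  linarith

/-- The scales seeing the frequency `m` have total weight `O(1 / m²)`. -/
lemma sum_four_pow_inv_le (L m : ℕ) (hm : 0 < m) :
    ∑ j ∈ Finset.range L, (if m < 2 * 2 ^ j then ((4 : ℝ) ^ j)⁻¹ else 0) ≤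
      16 / 3 / (m : ℝ) ^ 2 := by
  -- the tail of a geometric series, strengthened for the induction
  have key : ∀ L : ℕ, ∑ j ∈ Finset.range L, (if m < 2 * 2 ^ j then ((4 : ℝ) ^ j)⁻¹ else 0) ≤
      if m < 2 ^ L then 16 / 3 / (m : ℝ) ^ 2 - 4 / 3 / 4 ^ L else 0 := by
    intro L
    have hm' : (0 : ℝ) < m := by exact_mod_cast hm
    induction L with
    | zero => simp [hm.ne']
    | succ L ih =>
      rw [Finset.sum_range_succ]
      have hLL : 2 ^ (L + 1) = 2 * 2 ^ L := pow_succ' 2 L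
      have h4 : (0 : ℝ) < 4 ^ L := by positivity
      have h5 : 4 / 3 / (4 : ℝ) ^ (L + 1) = 4 / 3 / 4 ^ L - (4 ^ L)⁻¹ := by
        rw [pow_succ]
        field_simp
        norm_num
      by_cases h1 : m < 2 ^ L
      · rw [if_pos h1] at ih
        rw [if_pos (by omega), if_pos (by omega), h5]
        linarith
      · rw [if_neg h1] at ih
        by_cases h2 : m < 2 * 2 ^ L
        · rw [if_pos h2, if_pos (by omega), h5]
          have h6 : (m : ℝ) ^ 2 ≤ 4 * 4 ^ L := by
            have : (m : ℝ) ≤ 2 * 2 ^ L := by exact_mod_cast h2.le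
            calc (m : ℝ) ^ 2 ≤ (2 * 2 ^ L) ^ 2 := by gcongr
              _ = 4 * 4 ^ L := by
                rw [mul_pow, ← pow_mul, mul_comm L, pow_mul]
                norm_num
          have h7 : 4 / 3 / (4 : ℝ) ^ L ≤ 16 / 3 / (m : ℝ) ^ 2 := by
            rw [div_le_div_iff₀ h4 (by positivity)]
            linarith
          linarith
        · rw [if_neg h2, if_neg (by omega)]
          linarith
  refine (key L).trans ?_
  split_ifs
  · have : (0 : ℝ) ≤ 4 / 3 / 4 ^ L := by positivity
    linarith
  · positivity

lemma sum_scaleEnergy_le (z : ℕ → ℂ) (L N : ℕ) :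
    ∑ j ∈ Finset.range L, scaleEnergy z j N ≤
      16 / 3 * ∑ m ∈ Finset.range (2 ^ L), ‖powerSum z N m‖ ^ 2 / (m : ℝ) ^ 2 := by
  have h1 : ∀ j ∈ Finset.range L, scaleEnergy z j N = ∑ m ∈ Finset.Ico 1 (2 ^ L),
      ‖powerSum z N m‖ ^ 2 * (if m < 2 * 2 ^ j then ((4 : ℝ) ^ j)⁻¹ else 0) := by
    intro j hj
    have hjL : 2 ^ (j + 1) ≤ 2 ^ L := pow_le_pow_right₀ one_le_two (Finset.mem_range.mp hj)
    rw [pow_succ'] at hjL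
    simp only [mul_ite, mul_zero]
    rw [← Finset.sum_filter, scaleEnergy]
    refine Finset.sum_congr ?_ fun m _ => div_eq_mul_inv _ _
    ext m
    simp only [Finset.mem_filter, Finset.mem_Ico]
    omega
  rw [Finset.sum_congr rfl h1, Finset.sum_comm, Finset.mul_sum]
  calc _ ≤ ∑ m ∈ Finset.Ico 1 (2 ^ L), 16 / 3 * (‖powerSum z N m‖ ^ 2 / (m : ℝ) ^ 2) := by
        refine Finset.sum_le_sum fun m hm => ?_
        rw [← Finset.mul_sum]
        refine (mul_le_mul_of_nonneg_left
          (sum_four_pow_inv_le L m (Finset.mem_Ico.mp hm).1) (by positivity)).trans_eq ?_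
        ring
    _ ≤ _ := Finset.sum_le_sum_of_subset_of_nonneg
        (fun m hm => Finset.mem_range.mpr (Finset.mem_Ico.mp hm).2) fun _ _ _ => by positivity

/-- Among the first `2 ^ (L + 1)` initial segments of a sequence on the unit circle there is one
whose energy is at least of order `L`. -/
lemma exists_energy_ge (z : ℕ → ℂ) (hz : ∀ n, ‖z n‖ = 1) (L : ℕ) :
    ∃ N < 2 * 2 ^ L,
      (L : ℝ) / 96 ≤ ∑ m ∈ Finset.range (2 ^ L), ‖powerSum z N m‖ ^ 2 / (m : ℝ) ^ 2 := by
  by_contra! hcon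
  have h1 : ∑ j ∈ Finset.range L, (2 : ℝ) ^ L / 8 ≤
      ∑ j ∈ Finset.range L, ∑ N ∈ Finset.range (2 * 2 ^ L), scaleEnergy z j N :=
    Finset.sum_le_sum fun j hj =>
      two_pow_div_eight_le_sum_scaleEnergy z hz j L (Finset.mem_range.mp hj).le
  rw [Finset.sum_comm, Finset.sum_const, Finset.card_range, nsmul_eq_mul] at h1
  have h2 : ∑ N ∈ Finset.range (2 * 2 ^ L), ∑ j ∈ Finset.range L, scaleEnergy z j N <
      ∑ N ∈ Finset.range (2 * 2 ^ L), 16 / 3 * ((L : ℝ) / 96) := by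
    refine Finset.sum_lt_sum_of_nonempty ⟨0, by simp⟩ fun N hN => ?_
    refine (sum_scaleEnergy_le z L N).trans_lt ?_
    have := hcon N (Finset.mem_range.mp hN)
    gcongr
  rw [Finset.sum_const, Finset.card_range, nsmul_eq_mul] at h2
  push_cast at h2
  -- The constant 96 makes the assumed upper bound 8/9 of the proved lower bound.
  have : 2 * (2 : ℝ) ^ L * (16 / 3 * ((L : ℝ) / 96)) = L * (2 ^ L / 8) * (8 / 9) := by ring
  have h3 : (0 : ℝ) ≤ L * (2 ^ L / 8) := by positivity
  linarith

/-! ### Fourier coefficients for a point inside the circle -/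

lemma integral_circleMap_pow_mul_conj_pow (n k : ℕ) :
    ∫ θ in (0 : ℝ)..2 * Real.pi, circleMap 0 1 θ ^ n * conj (circleMap 0 1 θ) ^ k =
      if n = k then 2 * (Real.pi : ℂ) else 0 := by
  have h : ∀ θ : ℝ, circleMap 0 1 θ ^ n * conj (circleMap 0 1 θ) ^ k =
      Complex.exp ((((n : ℤ) - k : ℤ) : ℂ) * Complex.I * θ) := by
    intro θ
    rw [circleMap_zero, Complex.ofReal_one, one_mul, ← Complex.exp_conj, ← Complex.exp_nat_mul,
      ← Complex.exp_nat_mul, ← Complex.exp_add]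
    congr 1
    simp
    ring
  simp only [h]
  split_ifs with hnk
  · simp [hnk]
  · have hne : ((((n : ℤ) - k : ℤ) : ℂ) * Complex.I) ≠ 0 := by
      refine mul_ne_zero ?_ Complex.I_ne_zero
      exact Int.cast_ne_zero.mpr (sub_ne_zero.mpr (Nat.cast_injective.ne hnk))
    rw [integral_exp_mul_complex hne]
    have : ((((n : ℤ) - k : ℤ) : ℂ) * Complex.I) * ((2 * Real.pi : ℝ) : ℂ) =
        (((n : ℤ) - k : ℤ) : ℂ) * (2 * Real.pi * Complex.I) := by push_cast; ring
    rw [this, Complex.exp_int_mul_two_pi_mul_I]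
    simp

/-- Since `|w - a| = |1 - a w̄|`, this is the real part of the Taylor series of `log (1 - a w̄)`.
The `k = 0` term vanishes because division by zero gives zero. -/
lemma hasSum_log_norm_sub (w a : ℂ) (hw : ‖w‖ = 1) (ha : ‖a‖ < 1) :
    HasSum (fun k : ℕ => -(1 / 2 : ℂ) * ((conj a * w) ^ k + (a * conj w) ^ k) / k)
      (Real.log ‖w - a‖) := by
  have h1 : ‖w - a‖ = ‖1 - a * conj w‖ := by
    have : w - a = w * (1 - a * conj w) := by
      rw [mul_sub, mul_one, mul_left_comm, Complex.mul_conj', hw]; simp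
    rw [this, norm_mul, hw, one_mul]
  have h2 : ‖a * conj w‖ < 1 := by rwa [norm_mul, Complex.norm_conj, hw, mul_one]
  have h3 := Complex.hasSum_taylorSeries_neg_log h2
  have h4 := (Complex.hasSum_conj.mpr (by simpa using h3) :
    HasSum (fun k : ℕ => conj ((a * conj w) ^ k / k))
      (conj (-Complex.log (1 - a * conj w))))
  have h5 := (h3.add h4).mul_left (-(1 / 2 : ℂ))
  have e1 : ((Real.log ‖w - a‖ : ℝ) : ℂ) = -(1 / 2 : ℂ) *
      (-Complex.log (1 - a * conj w) + conj (-Complex.log (1 - a * conj w))) := by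
    rw [h1, ← Complex.log_re, map_neg, Complex.re_eq_add_conj]
    ring
  rw [e1]
  refine h5.congr_fun fun k => ?_
  simp only [map_div₀, map_pow, map_mul, Complex.conj_conj, map_natCast]
  ring
lemma norm_circleMap_zero_one (θ : ℝ) : ‖circleMap 0 1 θ‖ = 1 := by simp

/-- The Fourier coefficients of `log ‖w - a‖` on the unit circle, for `a` inside. -/
lemma integral_pow_mul_log_norm_sub_of_norm_lt_one (a : ℂ) (ha : ‖a‖ < 1) (n : ℕ) :
    ∫ θ in (0 : ℝ)..2 * Real.pi, circleMap 0 1 θ ^ n * (Real.log ‖circleMap 0 1 θ - a‖ : ℂ) =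
      -(Real.pi : ℂ) * a ^ n / n := by
  have hsum := intervalIntegral.hasSum_integral_of_dominated_convergence (μ := volume)
    (a := 0) (b := 2 * Real.pi)
    (F := fun (k : ℕ) θ => circleMap 0 1 θ ^ n *
      (-(1 / 2 : ℂ) * ((conj a * circleMap 0 1 θ) ^ k + (a * conj (circleMap 0 1 θ)) ^ k) / k))
    (f := fun θ => circleMap 0 1 θ ^ n * (Real.log ‖circleMap 0 1 θ - a‖ : ℂ))
    (fun k _ => ‖a‖ ^ k)
    (fun k => by
      refine Continuous.aestronglyMeasurable ?_
      fun_prop)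
    (fun k => by
      refine ae_of_all _ fun θ _ => ?_
      rw [norm_mul, norm_pow, norm_circleMap_zero_one, one_pow, one_mul, norm_div, norm_mul]
      have h1 : ‖(conj a * circleMap 0 1 θ) ^ k + (a * conj (circleMap 0 1 θ)) ^ k‖ ≤
          2 * ‖a‖ ^ k := by
        refine (norm_add_le _ _).trans_eq ?_
        simp only [norm_pow, norm_mul, Complex.norm_conj, norm_circleMap_zero_one]
        ring
      rcases Nat.eq_zero_or_pos k with rfl | hk
      · simp
      · have h2 : (1 : ℝ) ≤ ‖(k : ℂ)‖ := by
          rw [Complex.norm_natCast]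
          exact_mod_cast hk
        refine (div_le_self (by positivity) h2).trans ?_
        rw [norm_neg]
        norm_num
        linarith)
    (ae_of_all _ fun _ _ => summable_geometric_of_lt_one (norm_nonneg _) ha)
    (intervalIntegrable_const)
    (ae_of_all _ fun θ _ => (hasSum_log_norm_sub _ a (norm_circleMap_zero_one θ) ha).mul_left _)
  have hterm : ∀ k : ℕ, ∫ θ in (0 : ℝ)..2 * Real.pi, circleMap 0 1 θ ^ n *
      (-(1 / 2 : ℂ) * ((conj a * circleMap 0 1 θ) ^ k + (a * conj (circleMap 0 1 θ)) ^ k) / k) =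
      if k = n then -(Real.pi : ℂ) * a ^ n / n else 0 := by
    intro k
    have h1 : ∀ θ : ℝ, circleMap 0 1 θ ^ n * (-(1 / 2 : ℂ) *
        ((conj a * circleMap 0 1 θ) ^ k + (a * conj (circleMap 0 1 θ)) ^ k) / k) =
        -(1 / 2 : ℂ) * conj a ^ k / k *
          (circleMap 0 1 θ ^ (n + k) * conj (circleMap 0 1 θ) ^ 0) +
        -(1 / 2 : ℂ) * a ^ k / k * (circleMap 0 1 θ ^ n * conj (circleMap 0 1 θ) ^ k) := by
      intro θ
      ring
    simp only [h1]
    rw [intervalIntegral.integral_add, intervalIntegral.integral_const_mul,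
      intervalIntegral.integral_const_mul, integral_circleMap_pow_mul_conj_pow,
      integral_circleMap_pow_mul_conj_pow]
    · rcases Nat.eq_zero_or_pos k with rfl | hk
      · by_cases hn : 0 = n
        · subst hn; simp
        · simp [hn]
      · rw [if_neg (by omega), mul_zero, zero_add]
        by_cases hn : n = k
        · subst hn
          simp
          ring
        · rw [if_neg hn, if_neg (Ne.symm hn), mul_zero]
    · exact Continuous.intervalIntegrable (by fun_prop) _ _
    · exact Continuous.intervalIntegrable (by fun_prop) _ _
  simp only [hterm] at hsum
  exact hsum.unique (hasSum_ite_eq n _)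

/-! ### Parseval and the `L²` norm -/

/-- Parseval's identity for a real function of mean zero. -/
lemma hasSum_sq_norm_integral_pow_mul {f : ℝ → ℝ}
    (hf : MemLp f 2 (volume.restrict (Set.Ioc 0 (2 * Real.pi))))
    (h0 : ∫ θ in (0 : ℝ)..2 * Real.pi, (f θ : ℂ) = 0) :
    HasSum (fun n : ℕ =>
        ‖∫ θ in (0 : ℝ)..2 * Real.pi, circleMap 0 1 θ ^ n * (f θ : ℂ)‖ ^ 2 / Real.pi)
      (∫ θ in (0 : ℝ)..2 * Real.pi, f θ ^ 2) := by
  have hpi : (0 : ℝ) < 2 * Real.pi := by positivity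
  have hP := hasSum_sq_fourierCoeffOn hpi (f := fun θ => (f θ : ℂ)) hf.ofReal
  have hfour : ∀ (n : ℕ) (θ : ℝ),
      fourier (-(-(n : ℤ))) (θ : AddCircle (2 * Real.pi - 0)) = circleMap 0 1 θ ^ n := by
    intro n θ
    rw [fourier_coe_apply, circleMap_zero, Complex.ofReal_one, one_mul, ← Complex.exp_nat_mul]
    congr 1
    have : (Real.pi : ℂ) ≠ 0 := by exact_mod_cast Real.pi_ne_zero
    push_cast
    field_simp
    ring
  have hneg : ∀ n : ℕ, ‖fourierCoeffOn hpi (fun θ => (f θ : ℂ)) (-(n : ℤ))‖ =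
      ‖∫ θ in (0 : ℝ)..2 * Real.pi, circleMap 0 1 θ ^ n * (f θ : ℂ)‖ / (2 * Real.pi) := by
    intro n
    rw [fourierCoeffOn_eq_integral, norm_smul, sub_zero, Real.norm_of_nonneg (by positivity)]
    simp only [smul_eq_mul]
    rw [div_mul_eq_mul_div, one_mul]
    congr 2
    refine intervalIntegral.integral_congr fun θ _ => ?_
    have := hfour n θ
    rw [sub_zero] at this
    simp only [this]
  -- As `f` is real, opposite frequencies have conjugate coefficients, so the two-sided series folds
  -- onto `ℕ`.
  have hpos : ∀ n : ℕ, ‖fourierCoeffOn hpi (fun θ => (f θ : ℂ)) (n : ℤ)‖ =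
      ‖fourierCoeffOn hpi (fun θ => (f θ : ℂ)) (-(n : ℤ))‖ := by
    intro n
    have : fourierCoeffOn hpi (fun θ => (f θ : ℂ)) (n : ℤ) =
        conj (fourierCoeffOn hpi (fun θ => (f θ : ℂ)) (-(n : ℤ))) := by
      rw [fourierCoeffOn_eq_integral, fourierCoeffOn_eq_integral, Complex.real_smul,
        Complex.real_smul, map_mul, Complex.conj_ofReal,
        intervalIntegral.integral_of_le hpi.le, intervalIntegral.integral_of_le hpi.le,
        ← integral_conj]
      congr 2
      ext θ
      rw [smul_eq_mul, smul_eq_mul, map_mul, Complex.conj_ofReal, fourier_neg (n := -(n : ℤ)),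
        fourier_neg (n := (n : ℤ)), Complex.conj_conj]
    rw [this, Complex.norm_conj]
  have hz : fourierCoeffOn hpi (fun θ => (f θ : ℂ)) 0 = 0 := by
    rw [← norm_eq_zero]
    have := hneg 0
    simpa [h0] using this
  have h1 := hP.nat_add_neg
  simp only [hz, hpos, hneg] at h1
  have h2 := h1.mul_left (2 * Real.pi)
  have e1 : ∫ θ in (0 : ℝ)..2 * Real.pi, f θ ^ 2 = 2 * Real.pi *
      (((2 * Real.pi - 0)⁻¹ • ∫ θ in (0 : ℝ)..2 * Real.pi, ‖(f θ : ℂ)‖ ^ 2) + ‖(0 : ℂ)‖ ^ 2) := by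
    rw [sub_zero, smul_eq_mul]
    simp only [norm_zero, Complex.norm_real, Real.norm_eq_abs, sq_abs]
    field_simp
    ring
  rw [e1]
  refine h2.congr_fun fun n => ?_
  field_simp
  ring

lemma eLpNorm_two_eq_ofReal_sqrt {f : ℝ → ℝ}
    (hf : MemLp f 2 (volume.restrict (Set.Ioc 0 (2 * Real.pi)))) :
    eLpNorm f 2 (volume.restrict (Set.Ioc 0 (2 * Real.pi))) =
      ENNReal.ofReal (Real.sqrt (∫ θ in (0 : ℝ)..2 * Real.pi, f θ ^ 2)) := by
  rw [hf.eLpNorm_eq_integral_rpow_norm two_ne_zero ENNReal.ofNat_ne_top,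
    intervalIntegral.integral_of_le (by positivity), Real.sqrt_eq_rpow]
  simp

lemma continuous_log_norm_circleMap_sub {a : ℂ} (ha : ‖a‖ < 1) :
    Continuous fun θ : ℝ => Real.log ‖circleMap 0 1 θ - a‖ := by
  refine Continuous.log (by fun_prop) fun θ h => ?_
  have : ‖circleMap 0 1 θ‖ = 1 := norm_circleMap_zero_one θ
  rw [sub_eq_zero.mp (norm_eq_zero.mp h)] at this
  linarith

lemma memLp_log_norm_circleMap_sub_of_norm_lt_one {a : ℂ} (ha : ‖a‖ < 1) :
    MemLp (fun θ : ℝ => Real.log ‖circleMap 0 1 θ - a‖) 2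
      (volume.restrict (Set.Ioc 0 (2 * Real.pi))) := by
  have hc := continuous_log_norm_circleMap_sub ha
  obtain ⟨C, hC⟩ := isCompact_Icc.exists_bound_of_continuousOn
    (s := Set.Icc 0 (2 * Real.pi)) hc.continuousOn
  refine MemLp.of_bound hc.aestronglyMeasurable C ?_
  filter_upwards [ae_restrict_mem measurableSet_Ioc] with θ hθ
  exact hC θ (Set.Ioc_subset_Icc_self hθ)

/-- The bound is uniform in `a`, which is what lets `a` tend to the boundary. -/
lemma integral_sq_log_norm_circleMap_sub_le {a : ℂ} (ha : ‖a‖ < 1) :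
    ∫ θ in (0 : ℝ)..2 * Real.pi, Real.log ‖circleMap 0 1 θ - a‖ ^ 2 ≤
      Real.pi * ∑' n : ℕ, 1 / (n : ℝ) ^ 2 := by
  -- At `n = 0` the formula divides by zero and so correctly gives mean zero.
  have h0 := integral_pow_mul_log_norm_sub_of_norm_lt_one a ha 0
  simp only [pow_zero, one_mul, Nat.cast_zero, div_zero] at h0
  have h := hasSum_sq_norm_integral_pow_mul (memLp_log_norm_circleMap_sub_of_norm_lt_one ha) h0
  have hsum : Summable fun n : ℕ => 1 / (n : ℝ) ^ 2 := Real.summable_one_div_nat_pow.mpr one_lt_two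
  refine hasSum_le (fun n => ?_) h (hsum.hasSum.mul_left Real.pi)
  rw [integral_pow_mul_log_norm_sub_of_norm_lt_one a ha n]
  simp only [norm_div, norm_mul, norm_neg, norm_pow, Complex.norm_natCast, Complex.norm_real,
    Real.norm_of_nonneg Real.pi_pos.le, div_pow, mul_pow]
  have h1 : (‖a‖ ^ n) ^ 2 ≤ 1 := pow_le_one₀ (by positivity) (pow_le_one₀ (norm_nonneg _) ha.le)
  rw [div_right_comm, mul_div_right_comm, sq Real.pi, mul_self_div_self, mul_div_assoc]
  gcongr

/-! ### Radial passage to points on the circle -/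

/-- A sequence of radii increasing to one. -/
noncomputable def radius (j : ℕ) : ℝ := 1 - 1 / ((j : ℝ) + 1)

lemma radius_nonneg (j : ℕ) : 0 ≤ radius j := by
  have : (1 : ℝ) / ((j : ℝ) + 1) ≤ 1 := div_le_one_of_le₀ (by linarith [j.cast_nonneg (α := ℝ)])
    (by positivity)
  rw [radius]
  linarith

lemma radius_lt_one (j : ℕ) : radius j < 1 := by
  have : (0 : ℝ) < 1 / ((j : ℝ) + 1) := by positivity
  rw [radius]
  linarith

lemma tendsto_radius : Tendsto radius atTop (𝓝 1) := by
  have := (tendsto_one_div_add_atTop_nhds_zero_nat (𝕜 := ℝ)).const_sub 1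
  rwa [sub_zero] at this

lemma norm_radius_mul_lt_one {z : ℂ} (hz : ‖z‖ = 1) (j : ℕ) : ‖(radius j : ℂ) * z‖ < 1 := by
  rw [norm_mul, hz, mul_one, Complex.norm_real, Real.norm_of_nonneg (radius_nonneg j)]
  exact radius_lt_one j

lemma ae_circleMap_ne (z : ℂ) : ∀ᵐ θ : ℝ, circleMap 0 1 θ ≠ z :=
  ((Set.countable_singleton z).preimage_circleMap 0 one_ne_zero).ae_notMem volume

lemma tendsto_log_norm_sub_radius_mul {w z : ℂ} (h : w ≠ z) :
    Tendsto (fun j => Real.log ‖w - radius j * z‖) atTop (𝓝 (Real.log ‖w - z‖)) := by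
  refine Tendsto.log ?_ (norm_ne_zero_iff.mpr (sub_ne_zero.mpr h))
  have h1 := (Complex.continuous_ofReal.tendsto 1).comp tendsto_radius
  simpa using ((h1.mul_const z).const_sub w).norm

/-- Both `|w - r z|` and `|r z - z| = 1 - r ≤ |w - r z|` enter the triangle inequality, so `|w - z|
/ 2 ≤ |w - r z| ≤ 2`. This provides the majorant for dominated convergence. -/
lemma abs_log_norm_sub_radius_mul_le {w z : ℂ} (hw : ‖w‖ = 1) (hz : ‖z‖ = 1) (h : w ≠ z) (j : ℕ) :
    |Real.log ‖w - radius j * z‖| ≤ Real.log 2 + |Real.log ‖w - z‖| := by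
  have hpos : 0 < ‖w - z‖ := norm_pos_iff.mpr (sub_ne_zero.mpr h)
  have hr : ‖(radius j : ℂ) * z‖ = radius j := by
    rw [norm_mul, hz, mul_one, Complex.norm_real, Real.norm_of_nonneg (radius_nonneg j)]
  have h1 : 1 - radius j ≤ ‖w - radius j * z‖ := by
    have := norm_sub_norm_le w (radius j * z)
    rwa [hw, hr] at this
  have h2 : ‖w - z‖ ≤ ‖w - radius j * z‖ + (1 - radius j) := by
    have h3 : w - z = (w - radius j * z) - ((1 - radius j : ℝ) : ℂ) * z := by
      push_cast
      ring
    have h4 : ‖((1 - radius j : ℝ) : ℂ) * z‖ = 1 - radius j := by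
      rw [norm_mul, hz, mul_one, Complex.norm_real,
        Real.norm_of_nonneg (by linarith [radius_lt_one j])]
    calc ‖w - z‖ = ‖(w - radius j * z) - ((1 - radius j : ℝ) : ℂ) * z‖ := by rw [← h3]
      _ ≤ _ := (norm_sub_le _ _).trans_eq (by rw [h4])
  have h5 : ‖w - radius j * z‖ ≤ 2 := by
    refine (norm_sub_le _ _).trans ?_
    rw [hw, hr]
    linarith [radius_lt_one j]
  have h6 : ‖w - z‖ / 2 ≤ ‖w - radius j * z‖ := by linarith
  have h7 : Real.log ‖w - radius j * z‖ ≤ Real.log 2 := Real.log_le_log (by linarith) h5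
  have h8 := Real.log_le_log (by positivity) h6
  rw [Real.log_div hpos.ne' two_ne_zero] at h8
  rw [abs_le]
  constructor
  · linarith [neg_abs_le (Real.log ‖w - z‖)]
  · linarith [abs_nonneg (Real.log ‖w - z‖)]

lemma aestronglyMeasurable_log_norm_circleMap_sub (z : ℂ) (μ : Measure ℝ) :
    AEStronglyMeasurable (fun θ : ℝ => Real.log ‖circleMap 0 1 θ - z‖) μ := by
  have : Measurable fun θ : ℝ => ‖circleMap 0 1 θ - z‖ :=
    Continuous.measurable (by fun_prop)
  exact (Real.measurable_log.comp this).aestronglyMeasurable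

/-- Fatou's lemma along the radius, from the uniform `L²` bound inside the disc. -/
lemma memLp_log_norm_circleMap_sub {z : ℂ} (hz : ‖z‖ = 1) :
    MemLp (fun θ : ℝ => Real.log ‖circleMap 0 1 θ - z‖) 2
      (volume.restrict (Set.Ioc 0 (2 * Real.pi))) := by
  refine ⟨aestronglyMeasurable_log_norm_circleMap_sub z _, ?_⟩
  refine (Lp.eLpNorm_lim_le_liminf_eLpNorm
    (f := fun j θ => Real.log ‖circleMap 0 1 θ - radius j * z‖)
    (fun j => aestronglyMeasurable_log_norm_circleMap_sub _ _) _
    (ae_restrict_of_ae ((ae_circleMap_ne z).mono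
      fun θ hθ => tendsto_log_norm_sub_radius_mul hθ))).trans_lt ?_
  refine lt_of_le_of_lt (b := ENNReal.ofReal (Real.sqrt (Real.pi * ∑' n : ℕ, 1 / (n : ℝ) ^ 2)))
    (liminf_le_of_frequently_le' (Frequently.of_forall fun j => ?_)) ENNReal.ofReal_lt_top
  rw [eLpNorm_two_eq_ofReal_sqrt
    (memLp_log_norm_circleMap_sub_of_norm_lt_one (norm_radius_mul_lt_one hz j))]
  gcongr
  exact integral_sq_log_norm_circleMap_sub_le (norm_radius_mul_lt_one hz j)

lemma intervalIntegrable_of_memLp_two {f : ℝ → ℝ}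
    (hf : MemLp f 2 (volume.restrict (Set.Ioc 0 (2 * Real.pi)))) :
    IntervalIntegrable f volume 0 (2 * Real.pi) := by
  rw [intervalIntegrable_iff_integrableOn_Ioc_of_le (by positivity)]
  exact hf.integrable one_le_two

/-- The Fourier coefficients of `log ‖w - z‖` on the unit circle, for `z` on the circle. -/
lemma integral_pow_mul_log_norm_sub {z : ℂ} (hz : ‖z‖ = 1) (n : ℕ) :
    ∫ θ in (0 : ℝ)..2 * Real.pi, circleMap 0 1 θ ^ n * (Real.log ‖circleMap 0 1 θ - z‖ : ℂ) =
      -(Real.pi : ℂ) * z ^ n / n := by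
  have hlim := intervalIntegral.tendsto_integral_filter_of_dominated_convergence (μ := volume)
    (a := 0) (b := 2 * Real.pi) (l := atTop)
    (F := fun (j : ℕ) θ =>
      circleMap 0 1 θ ^ n * (Real.log ‖circleMap 0 1 θ - radius j * z‖ : ℂ))
    (f := fun θ => circleMap 0 1 θ ^ n * (Real.log ‖circleMap 0 1 θ - z‖ : ℂ))
    (fun θ => Real.log 2 + |Real.log ‖circleMap 0 1 θ - z‖|)
    (Eventually.of_forall fun j => by
      have := continuous_log_norm_circleMap_sub (norm_radius_mul_lt_one hz j)
      exact Continuous.aestronglyMeasurable (by fun_prop))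
    (Eventually.of_forall fun j => (ae_circleMap_ne z).mono fun θ hθ _ => by
      rw [norm_mul, norm_pow, norm_circleMap_zero_one, one_pow, one_mul, Complex.norm_real]
      exact abs_log_norm_sub_radius_mul_le (norm_circleMap_zero_one θ) hz hθ j)
    (intervalIntegrable_const.add
      (intervalIntegrable_of_memLp_two (memLp_log_norm_circleMap_sub hz)).abs)
    ((ae_circleMap_ne z).mono fun θ hθ _ => Tendsto.const_mul _
      ((Complex.continuous_ofReal.tendsto _).comp (tendsto_log_norm_sub_radius_mul hθ)))
  refine tendsto_nhds_unique hlim ?_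
  simp only [fun j => integral_pow_mul_log_norm_sub_of_norm_lt_one _
    (norm_radius_mul_lt_one hz j) n]
  have h1 := (Complex.continuous_ofReal.tendsto 1).comp tendsto_radius
  have h2 := ((((h1.mul_const z).pow n).const_mul (-(Real.pi : ℂ))).div_const (n : ℂ))
  simpa using h2

/-! ### The norm of the product, and the two bounds -/

lemma logProd_ae_eq (z : ℕ → ℂ) (N : ℕ) :
    ∀ᵐ θ : ℝ, logProd z N (circleMap 0 1 θ) =
      ∑ k ∈ Finset.range N, Real.log ‖circleMap 0 1 θ - z k‖ := by
  filter_upwards [ae_all_iff.mpr fun k => ae_circleMap_ne (z k)] with θ hθ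
  rw [logProd, norm_prod, Real.log_prod]
  exact fun k _ => norm_ne_zero_iff.mpr (sub_ne_zero.mpr (hθ k))

lemma memLp_sum_log_norm_sub {z : ℕ → ℂ} (hz : ∀ n, ‖z n‖ = 1) (N : ℕ) :
    MemLp (fun θ : ℝ => ∑ k ∈ Finset.range N, Real.log ‖circleMap 0 1 θ - z k‖) 2
      (volume.restrict (Set.Ioc 0 (2 * Real.pi))) :=
  memLp_finsetSum _ fun k _ => memLp_log_norm_circleMap_sub (hz k)

lemma integral_pow_mul_sum_log_norm_sub {z : ℕ → ℂ} (hz : ∀ n, ‖z n‖ = 1) (N n : ℕ) :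
    ∫ θ in (0 : ℝ)..2 * Real.pi, circleMap 0 1 θ ^ n *
        ((∑ k ∈ Finset.range N, Real.log ‖circleMap 0 1 θ - z k‖ : ℝ) : ℂ) =
      -(Real.pi : ℂ) * powerSum z N n / n := by
  simp only [Complex.ofReal_sum, Finset.mul_sum]
  rw [intervalIntegral.integral_finsetSum]
  · simp only [fun k => integral_pow_mul_log_norm_sub (hz k) n]
    rw [← Finset.sum_div, ← Finset.mul_sum, powerSum]
  · intro k _
    have h1 := intervalIntegrable_of_memLp_two (memLp_log_norm_circleMap_sub (hz k))
    have h2 : IntervalIntegrable (fun θ : ℝ => (Real.log ‖circleMap 0 1 θ - z k‖ : ℂ)) volume 0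
        (2 * Real.pi) := ⟨h1.1.ofReal, h1.2.ofReal⟩
    exact h2.continuousOn_mul (by fun_prop)

/-- The `L²` norm of `log |∏ (w - z_k)|` on the unit circle in terms of the power sums. -/
theorem exists_hasSum_and_circleL2Norm_logProd_eq {z : ℕ → ℂ} (hz : ∀ n, ‖z n‖ = 1) (N : ℕ) :
    ∃ E : ℝ, HasSum (fun m : ℕ => ‖powerSum z N m‖ ^ 2 / (m : ℝ) ^ 2) E ∧
      circleL2Norm (logProd z N) = ENNReal.ofReal (Real.sqrt (Real.pi * E)) := by
  have hmem := memLp_sum_log_norm_sub hz N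
  have h0 := integral_pow_mul_sum_log_norm_sub hz N 0
  simp only [pow_zero, one_mul, Nat.cast_zero, div_zero] at h0
  have h := hasSum_sq_norm_integral_pow_mul hmem h0
  have hpi : Real.pi ≠ 0 := Real.pi_ne_zero
  refine ⟨_, (h.div_const Real.pi).congr_fun fun m => ?_, ?_⟩
  · rw [integral_pow_mul_sum_log_norm_sub hz N m]
    simp only [norm_div, norm_mul, norm_neg, Complex.norm_natCast, Complex.norm_real,
      Real.norm_of_nonneg Real.pi_pos.le, div_pow, mul_pow]
    field_simp
  · rw [mul_div_cancel₀ _ hpi, ← eLpNorm_two_eq_ofReal_sqrt hmem, circleL2Norm]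
    exact eLpNorm_congr_ae (ae_restrict_of_ae (logProd_ae_eq z N))

lemma frequently_le_circleL2Norm {z : ℕ → ℂ} (hz : ∀ n, ‖z n‖ = 1) :
    ∃ᶠ N : ℕ in atTop,
      ENNReal.ofReal (1 / 16 * Real.sqrt (Real.log (N : ℝ))) ≤ circleL2Norm (logProd z N) := by
  choose E hE hnorm using exists_hasSum_and_circleL2Norm_logProd_eq hz
  rw [frequently_atTop]
  intro N₀
  -- the finitely many initial segments shorter than `N₀` have bounded energy
  obtain ⟨B, hB⟩ : ∃ B : ℝ, ∀ N ∈ Finset.range N₀, E N ≤ B :=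
    ((Finset.range N₀).image E).bddAbove.imp fun B hB N hN =>
      hB (Finset.mem_coe.mpr (Finset.mem_image_of_mem E hN))
  -- Energy at least `L / 96 > B` rules out `N < N₀`; `L > 1` serves in `log N ≤ (L + 1) log 2 ≤
  -- 2L`.
  obtain ⟨L, hL⟩ := exists_nat_gt (max 1 (96 * B))
  have hL1 : (1 : ℝ) < L := (le_max_left _ _).trans_lt hL
  have hL2 : 96 * B < L := (le_max_right _ _).trans_lt hL
  obtain ⟨N, hN, hNE⟩ := exists_energy_ge z hz L
  have hEN : (L : ℝ) / 96 ≤ E N :=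
    hNE.trans (sum_le_hasSum _ (fun _ _ => by positivity) (hE N))
  refine ⟨N, ?_, ?_⟩
  · by_contra! hlt
    linarith [hB N (Finset.mem_range.mpr hlt)]
  · rw [hnorm N]
    refine ENNReal.ofReal_le_ofReal (Real.le_sqrt_of_sq_le ?_)
    have hlog : Real.log N ≤ 2 * L := by
      rcases Nat.eq_zero_or_pos N with rfl | hpos
      · simp
      · calc Real.log N ≤ Real.log ((2 : ℝ) ^ (L + 1)) := by
              refine Real.log_le_log (by exact_mod_cast hpos) ?_
              rw [pow_succ']
              exact_mod_cast hN.le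
          _ = (L + 1) * Real.log 2 := by rw [Real.log_pow]; push_cast; ring
          _ ≤ (L + 1) * 1 := by
              gcongr
              linarith [Real.log_two_lt_d9]
          _ ≤ 2 * L := by linarith
    rw [mul_pow, Real.sq_sqrt (Real.log_natCast_nonneg N)]
    -- Thus `π E ≥ L / 32`, whereas `(1/16)² log N ≤ L / 128`.
    have h3 : 3 * ((L : ℝ) / 96) ≤ Real.pi * E N :=
      mul_le_mul Real.pi_gt_three.le hEN (by positivity) Real.pi_pos.le
    linarith

lemma circleL2Norm_logProd_vdcSeq_le (N : ℕ) (hN : 2 ≤ N) :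
    circleL2Norm (logProd vdcSeq N) ≤
      ENNReal.ofReal (Real.sqrt (16 * Real.pi * ∑' m : ℕ, 1 / (m : ℝ) ^ 2) *
        Real.sqrt (Real.log (N : ℝ))) := by
  obtain ⟨E, hE, hnorm⟩ := exists_hasSum_and_circleL2Norm_logProd_eq norm_vdcSeq N
  set Z := ∑' m : ℕ, 1 / (m : ℝ) ^ 2
  have hZ : 0 ≤ Z := tsum_nonneg fun _ => by positivity
  have hEle : E ≤ 4 * (Nat.log 2 N + 1 : ℕ) * Z :=
    le_of_tendsto hE.tendsto_sum_nat (Eventually.of_forall fun M =>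
      sum_sq_powerSum_vdcSeq_le _ N M (Nat.lt_pow_succ_log_self one_lt_two N))
  -- Since `N ≥ 2`, the added 1 is absorbed by doubling `Nat.log 2 N`; another factor 2 comes from
  -- `log 2 > 1/2`.
  have hlog : ((Nat.log 2 N + 1 : ℕ) : ℝ) ≤ 4 * Real.log N := by
    have h1 : (1 : ℝ) ≤ Nat.log 2 N := by
      exact_mod_cast Nat.log_pos one_lt_two hN
    have h2 : (Nat.log 2 N : ℝ) * Real.log 2 ≤ Real.log N := by
      rw [← Real.log_pow]
      refine Real.log_le_log (by positivity) ?_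
      exact_mod_cast Nat.pow_log_le_self 2 (by omega)
    have h3 : (Nat.log 2 N : ℝ) * (1 / 2) ≤ Nat.log 2 N * Real.log 2 := by
      gcongr
      linarith [Real.log_two_gt_d9]
    push_cast
    linarith
  rw [hnorm, ← Real.sqrt_mul (by positivity)]
  refine ENNReal.ofReal_le_ofReal (Real.sqrt_le_sqrt ?_)
  calc Real.pi * E ≤ Real.pi * (4 * (Nat.log 2 N + 1 : ℕ) * Z) := by gcongr
    _ ≤ Real.pi * (4 * (4 * Real.log N) * Z) := by gcongr
    _ = 16 * Real.pi * Z * Real.log N := by ring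

theorem theorem3 :
    (∃ c : ℝ, 0 < c ∧ ∀ z : ℕ → ℂ, (∀ n, ‖z n‖ = 1) →
      ∃ᶠ N : ℕ in Filter.atTop,
        ENNReal.ofReal (c * Real.sqrt (Real.log (N : ℝ))) ≤ circleL2Norm (logProd z N)) ∧
    (∃ C : ℝ, 0 < C ∧ ∃ z : ℕ → ℂ, (∀ n, ‖z n‖ = 1) ∧
      ∀ N : ℕ, 2 ≤ N →
        circleL2Norm (logProd z N) ≤ ENNReal.ofReal (C * Real.sqrt (Real.log (N : ℝ)))) := by
  refine ⟨⟨1 / 16, by norm_num, fun z hz => frequently_le_circleL2Norm hz⟩,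
    Real.sqrt (16 * Real.pi * ∑' m : ℕ, 1 / (m : ℝ) ^ 2), ?_, vdcSeq, norm_vdcSeq,
    circleL2Norm_logProd_vdcSeq_le⟩
  have hsum : Summable fun m : ℕ => 1 / (m : ℝ) ^ 2 := Real.summable_one_div_nat_pow.mpr one_lt_two
  have hpos : 0 < ∑' m : ℕ, 1 / (m : ℝ) ^ 2 :=
    hsum.tsum_pos (fun _ => by positivity) 1 (by norm_num)
  positivity
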